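/- Let $n\ge 2$, let $\mu_0,\dots,\mu_{n+2}\in\mathbb{C}$ be pairwise distinct, and let $X\subset\mathbb{P}=\mathbb{P}^{n+2}_{\mathbb{C}}$ be the intersection of the two quadrics $$q_1=\sum_{i=0}^{n+2}x_i^2=0,\qquad q_2=\sum_{i=0}^{n+2}\mu_i x_i^2=0 .$$ Write $\partial_j=\partial/\partial x_j$; the linear vector fields $x_i\partial_j-x_j\partial_i$ on $\mathbb{C}^{n+3}$ induce vector fields on $\mathbb{P}$, hence sections of $T_{\mathbb{P}|X}$ over $X$. Then for every $i\in\{0,\dots,n+2\}$ the quadratic vector field $$s_i:=\sum_{j\neq i}\frac{(x_i\partial_j-x_j\partial_i)^2}{\mu_j-\mu_i}\ \in\ H^0(X,\mathsf{S}^2T_{\mathbb{P}|X})$$ belongs to the image of the natural map $H^0(X,\mathsf{S}^2T_X)\to H^0(X,\mathsf{S}^2T_{\mathbb{P}|X})$. -/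

import Mathlib

open scoped TensorProduct

noncomputable section

namespace TwoQuadrics

/-! ### Restriction of derivations to a localization -/

section Restrict

variable {K B A B' A' : Type*} [CommRing K] [CommRing B] [CommRing A] [CommRing B'] [CommRing A']
  [Algebra K B] [Algebra K A] [Algebra K B'] [Algebra K A'] [Algebra B A] [Algebra B' A']

theorem existsUnique_restrict (ρ : B →ₐ[K] B') (σ : A →ₐ[K] A')
    (hcomm : ∀ b, σ (algebraMap B A b) = algebraMap B' A' (ρ b))
    [IsScalarTower K B' A']
    (hloc : ∃ r : B, @IsLocalization.Away B _ r B' _ ρ.toRingHom.toAlgebra)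
    (D : Derivation K B A) :
    ∃! D' : Derivation K B' A', ∀ b, D' (ρ b) = σ (D b) := by
  obtain ⟨r, hr⟩ := hloc
  let _ : Algebra B B' := ρ.toRingHom.toAlgebra
  have hρ : ∀ b, algebraMap B B' b = ρ b := fun _ => rfl
  have : IsScalarTower K B B' := .of_algebraMap_eq (fun x => (ρ.commutes x).symm)
  let _ : Algebra B A' := ((algebraMap B' A').comp (algebraMap B B')).toAlgebra
  have : IsScalarTower B B' A' := .of_algebraMap_eq (fun _ => rfl)
  have : IsScalarTower K B A' := .of_algebraMap_eq (fun x => by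
    rw [IsScalarTower.algebraMap_apply B B' A', ← IsScalarTower.algebraMap_apply K B B',
      ← IsScalarTower.algebraMap_apply K B' A'])
  have : Algebra.FormallyEtale B B' := .of_isLocalization (Submonoid.powers r)
  -- the derivation `σ ∘ D`
  let D₁ : Derivation K B A' :=
    { toLinearMap := σ.toLinearMap.comp D.toLinearMap
      map_one_eq_zero' := by simp
      leibniz' := fun a b => by
        simp only [LinearMap.comp_apply, Derivation.coeFn_coe, AlgHom.toLinearMap_apply,
          Derivation.leibniz, map_add, Algebra.smul_def, map_mul, hcomm]
        rfl }
  let e := KaehlerDifferential.tensorKaehlerEquivOfFormallyEtale K B B'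
  let L : Ω[B'⁄K] →ₗ[B'] A' :=
    (LinearMap.liftBaseChange B' D₁.liftKaehlerDifferential).comp e.symm.toLinearMap
  refine ⟨L.compDer (KaehlerDifferential.D K B'), fun b => ?_, fun D₂ h₂ => ?_⟩
  · change L (KaehlerDifferential.D K B' (algebraMap B B' b)) = _
    simp only [L, e, LinearMap.comp_apply, LinearEquiv.coe_coe]
    rw [KaehlerDifferential.tensorKaehlerEquivOfFormallyEtale_symm_D_algebraMap]
    simp [D₁]
  · ext b'
    obtain ⟨b, s, rfl⟩ := IsLocalization.exists_mk'_eq (Submonoid.powers r) b'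
    have key : ∀ E : Derivation K B' A', (∀ b, E (ρ b) = σ (D b)) →
        E (IsLocalization.mk' B' b s) = (IsLocalization.mk' B' 1 s) •
          (σ (D b) - IsLocalization.mk' B' b s • σ (D s)) := by
      intro E hE
      have h1 : algebraMap B B' s * IsLocalization.mk' B' b s = algebraMap B B' b := by
        rw [mul_comm, IsLocalization.mk'_spec]
      have h2 := congrArg E h1
      rw [Derivation.leibniz, hρ, hρ, hE, hE, ← hρ] at h2
      have h3 : IsLocalization.mk' B' 1 s * algebraMap B B' s = 1 := by
        rw [IsLocalization.mk'_spec, map_one]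
      rw [← h2, add_sub_cancel_right, smul_smul, h3, one_smul]
    rw [key D₂ h₂, key _ ?_]
    intro b
    change L (KaehlerDifferential.D K B' (algebraMap B B' b)) = _
    simp only [L, e, LinearMap.comp_apply, LinearEquiv.coe_coe]
    rw [KaehlerDifferential.tensorKaehlerEquivOfFormallyEtale_symm_D_algebraMap]
    simp [D₁]

/-- Restriction of derivations to a localization `B → B'`: the unique derivation `D'` of `B'`
such that `D' ∘ ρ = σ ∘ D`. -/
def restrictDer (ρ : B →ₐ[K] B') (σ : A →ₐ[K] A')
    (hcomm : ∀ b, σ (algebraMap B A b) = algebraMap B' A' (ρ b))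
    [IsScalarTower K B' A']
    (hloc : ∃ r : B, @IsLocalization.Away B _ r B' _ ρ.toRingHom.toAlgebra) :
    Derivation K B A →ₛₗ[σ.toRingHom] Derivation K B' A' where
  toFun D := (existsUnique_restrict ρ σ hcomm hloc D).choose
  map_add' D E := by
    refine ((existsUnique_restrict ρ σ hcomm hloc (D + E)).choose_spec.2 _ fun b => ?_).symm
    rw [Derivation.add_apply, (existsUnique_restrict ρ σ hcomm hloc D).choose_spec.1,
      (existsUnique_restrict ρ σ hcomm hloc E).choose_spec.1, Derivation.add_apply, map_add]
  map_smul' a D := by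
    refine ((existsUnique_restrict ρ σ hcomm hloc (a • D)).choose_spec.2 _ fun b => ?_).symm
    rw [Derivation.smul_apply, (existsUnique_restrict ρ σ hcomm hloc D).choose_spec.1,
      Derivation.smul_apply, smul_eq_mul, smul_eq_mul, map_mul]
    rfl

theorem restrictDer_apply (ρ : B →ₐ[K] B') (σ : A →ₐ[K] A')
    (hcomm : ∀ b, σ (algebraMap B A b) = algebraMap B' A' (ρ b))
    [IsScalarTower K B' A']
    (hloc : ∃ r : B, @IsLocalization.Away B _ r B' _ ρ.toRingHom.toAlgebra)
    (D : Derivation K B A) (b : B) :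
    restrictDer ρ σ hcomm hloc D (ρ b) = σ (D b) :=
  (existsUnique_restrict ρ σ hcomm hloc D).choose_spec.1 b

end Restrict

/-! ### Graded algebras: quotients, homogeneous localizations -/

section Graded

open HomogeneousLocalization

variable {K S : Type*} [CommRing K] [CommRing S] [Algebra K S]

section Quot

variable (𝒜 : ℕ → Submodule K S) (I : Ideal S)

/-- The grading of `S ⧸ I` by the images of the graded pieces of `S`. -/
def quotGrading (d : ℕ) : Submodule K (S ⧸ I) :=
  (𝒜 d).map (Ideal.Quotient.mkₐ K I).toLinearMap

variable {𝒜 I} in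
theorem mk_mem_quotGrading {d : ℕ} {a : S} (ha : a ∈ 𝒜 d) :
    Ideal.Quotient.mk I a ∈ quotGrading 𝒜 I d :=
  ⟨a, ha, rfl⟩

instance quotGrading.gradedMonoid [SetLike.GradedMonoid 𝒜] :
    SetLike.GradedMonoid (quotGrading 𝒜 I) where
  one_mem := ⟨1, SetLike.GradedOne.one_mem, rfl⟩
  mul_mem := by
    rintro i j _ _ ⟨a, ha, rfl⟩ ⟨b, hb, rfl⟩
    exact ⟨a * b, SetLike.mul_mem_graded ha hb, map_mul (Ideal.Quotient.mk I) a b⟩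

/-- The quotient map on the piece of degree `d`. -/
def quotPiece (d : ℕ) : 𝒜 d →ₗ[K] quotGrading 𝒜 I d where
  toFun a := ⟨Ideal.Quotient.mk I a, mk_mem_quotGrading a.2⟩
  map_add' _ _ := rfl
  map_smul' _ _ := rfl

theorem quotPiece_one [SetLike.GradedMonoid 𝒜] :
    (DirectSum.lof K ℕ (fun d => quotGrading 𝒜 I d) 0).comp (quotPiece 𝒜 I 0)
      (GradedMonoid.GOne.one (A := fun d => 𝒜 d)) = 1 :=
  rfl

theorem quotPiece_mul [SetLike.GradedMonoid 𝒜] {i j : ℕ} (a : 𝒜 i) (b : 𝒜 j) :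
    (DirectSum.lof K ℕ (fun d => quotGrading 𝒜 I d) (i + j)).comp (quotPiece 𝒜 I (i + j))
      (GradedMonoid.GMul.mul (A := fun d => 𝒜 d) a b) =
    (DirectSum.lof K ℕ (fun d => quotGrading 𝒜 I d) i).comp (quotPiece 𝒜 I i) a *
      (DirectSum.lof K ℕ (fun d => quotGrading 𝒜 I d) j).comp (quotPiece 𝒜 I j) b := by
  simp only [LinearMap.comp_apply, DirectSum.lof_eq_of, DirectSum.of_mul_of]
  rfl

variable [GradedAlgebra 𝒜]

/-- `a ↦ ∑ d, (a_d mod I)`. -/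
def quotDecomposeAux : S →ₐ[K] DirectSum ℕ fun d => quotGrading 𝒜 I d :=
  (DirectSum.toAlgebra K (fun d => 𝒜 d)
    (fun d => (DirectSum.lof K ℕ (fun d => quotGrading 𝒜 I d) d).comp
      (quotPiece 𝒜 I d))
    (quotPiece_one 𝒜 I) (quotPiece_mul 𝒜 I)).comp (DirectSum.decomposeAlgEquiv 𝒜).toAlgHom

theorem quotDecomposeAux_of_mem {d : ℕ} {a : S} (ha : a ∈ 𝒜 d) :
    quotDecomposeAux 𝒜 I a =
      DirectSum.of (fun d => quotGrading 𝒜 I d) d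
        ⟨Ideal.Quotient.mk I a, mk_mem_quotGrading ha⟩ := by
  simp only [quotDecomposeAux, AlgHom.comp_apply]
  have : (DirectSum.decomposeAlgEquiv 𝒜).toAlgHom a = DirectSum.of (fun d => 𝒜 d) d ⟨a, ha⟩ :=
    DirectSum.decompose_of_mem 𝒜 ha
  rw [this]
  exact DirectSum.toSemiring_of
    (f := fun d => ((DirectSum.lof K ℕ (fun d => quotGrading 𝒜 I d) d).comp
      (quotPiece 𝒜 I d)).toAddMonoidHom)
    (quotPiece_one 𝒜 I) (quotPiece_mul 𝒜 I) d ⟨a, ha⟩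

/-- The quotient of a graded algebra by a homogeneous ideal is graded. -/
abbrev quotGradedAlgebra (hI : I.IsHomogeneous 𝒜) : GradedAlgebra (quotGrading 𝒜 I) :=
  GradedAlgebra.ofAlgHom (quotGrading 𝒜 I)
    (Ideal.Quotient.liftₐ I (quotDecomposeAux 𝒜 I) (fun a ha => by
      classical
      rw [← DirectSum.sum_support_decompose 𝒜 a, map_sum]
      refine Finset.sum_eq_zero fun d _ => ?_
      rw [quotDecomposeAux_of_mem 𝒜 I (SetLike.coe_mem _)]
      have h0 : Ideal.Quotient.mk I (DirectSum.decompose 𝒜 a d : S) = 0 :=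
        Ideal.Quotient.eq_zero_iff_mem.2 (hI d ha)
      rw [show (⟨Ideal.Quotient.mk I (DirectSum.decompose 𝒜 a d : S), _⟩ :
        quotGrading 𝒜 I d) = 0 from Subtype.ext h0, map_zero]))
    (by
      classical
      refine Ideal.Quotient.algHom_ext _ ?_
      ext a
      simp only [AlgHom.comp_apply]
      change DirectSum.coeAlgHom (quotGrading 𝒜 I) (quotDecomposeAux 𝒜 I a) =
        Ideal.Quotient.mk I a
      conv_rhs => rw [← DirectSum.sum_support_decompose 𝒜 a, map_sum]
      conv_lhs => rw [← DirectSum.sum_support_decompose 𝒜 a, map_sum, map_sum]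
      refine Finset.sum_congr rfl fun d _ => ?_
      rw [quotDecomposeAux_of_mem 𝒜 I (SetLike.coe_mem _), DirectSum.coeAlgHom_of])
    (by
      rintro d ⟨_, a, ha, rfl⟩
      exact quotDecomposeAux_of_mem 𝒜 I ha)

end Quot

variable (𝒜 : ℕ → Submodule K S) [GradedAlgebra 𝒜]

instance awayAlgebra (f : S) : Algebra K (Away 𝒜 f) where
  algebraMap := (algebraMap (𝒜 0) (Away 𝒜 f)).comp (algebraMap K (𝒜 0))
  commutes' _ _ := mul_comm _ _
  smul_def' c y := by
    apply val_injective
    rw [val_smul, val_mul, Algebra.smul_def]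
    rfl

theorem val_algebraMap_away (f : S) (c : K) :
    (algebraMap K (Away 𝒜 f) c).val = algebraMap K (Localization.Away f) c := rfl

/-- The restriction map `S_(f) → S_(w)` for `w = f * g`, as a map of `K`-algebras. -/
def awayRes {f g w : S} {e : ℕ} (hg : g ∈ 𝒜 e) (hw : w = f * g) : Away 𝒜 f →ₐ[K] Away 𝒜 w :=
  { awayMap 𝒜 hg hw with
    commutes' := fun c => awayMap_fromZeroRingHom 𝒜 hg hw (algebraMap K (𝒜 0) c) }

theorem awayRes_isLocalization {f g w : S} {d e : ℕ} (hf : f ∈ 𝒜 d) (hg : g ∈ 𝒜 e)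
    (hw : w = f * g) (hd : d ≠ 0) :
    ∃ r : Away 𝒜 f, @IsLocalization.Away _ _ r (Away 𝒜 w) _
      (awayRes 𝒜 hg hw).toRingHom.toAlgebra :=
  ⟨_, Away.isLocalization_mul hf hg hw hd⟩

/-- The derivation of `S_f` extending a derivation `D` of `S`. -/
theorem existsUnique_extend (D : Derivation K S S) (f : S) :
    ∃! D' : Derivation K (Localization.Away f) (Localization.Away f),
      ∀ a, D' (algebraMap S _ a) = algebraMap S _ (D a) :=
  existsUnique_restrict (IsScalarTower.toAlgHom K S (Localization.Away f))
    (IsScalarTower.toAlgHom K S (Localization.Away f)) (fun _ => rfl)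
    ⟨f, by
      convert! (inferInstance : IsLocalization.Away f (Localization.Away f))
      all_goals exact Algebra.algebra_ext _ _ fun _ => rfl⟩ D

/-- A derivation `D` of `S` which preserves degrees induces a derivation of the degree zero part
`S_(f)` of `S_f`: the restriction of the unique extension of `D` to `S_f`. -/
theorem existsUnique_away (D : Derivation K S S) (hD : ∀ d, ∀ a ∈ 𝒜 d, D a ∈ 𝒜 d)
    {f : S} {d : ℕ} (hf : f ∈ 𝒜 d) :
    ∃! D' : Derivation K (Away 𝒜 f) (Away 𝒜 f),
      ∀ b, (D' b).val = (existsUnique_extend D f).choose b.val := by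
  have hE := (existsUnique_extend D f).choose_spec.1
  set E := (existsUnique_extend D f).choose with hEdef
  have hmem : ∀ b : Away 𝒜 f, ∃ c : Away 𝒜 f, c.val = E b.val := by
    intro b
    obtain ⟨m, a, ha, rfl⟩ := Away.mk_surjective 𝒜 hf b
    refine ⟨Away.mk 𝒜 hf (m + m) (f ^ m * D a - a * D (f ^ m)) ?_, ?_⟩
    · rw [add_smul]
      refine sub_mem (SetLike.mul_mem_graded (SetLike.pow_mem_graded m hf) (hD _ _ ha))
        (SetLike.mul_mem_graded ha (hD _ _ (SetLike.pow_mem_graded m hf)))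
    · rw [Away.val_mk, Away.val_mk]
      have hu : IsUnit (algebraMap S (Localization.Away f) (f ^ m)) :=
        IsLocalization.map_units (Localization.Away f) (⟨f ^ m, m, rfl⟩ : Submonoid.powers f)
      have h1 : algebraMap S (Localization.Away f) (f ^ m) *
          Localization.mk a (⟨f ^ m, m, rfl⟩ : Submonoid.powers f) = algebraMap S _ a := by
        rw [mul_comm, Localization.mk_eq_mk']
        exact IsLocalization.mk'_spec _ a (⟨f ^ m, m, rfl⟩ : Submonoid.powers f)
      have h2 := congrArg E h1
      rw [Derivation.leibniz, hE, hE, smul_eq_mul, smul_eq_mul] at h2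
      have h3 : algebraMap S (Localization.Away f) (f ^ (m + m)) *
          Localization.mk (f ^ m * D a - a * D (f ^ m)) (⟨f ^ (m + m), m + m, rfl⟩ : Submonoid.powers f) =
            algebraMap S _ (f ^ m * D a - a * D (f ^ m)) := by
        rw [mul_comm, Localization.mk_eq_mk']
        exact IsLocalization.mk'_spec _ _ (⟨f ^ (m + m), m + m, rfl⟩ : Submonoid.powers f)
      apply (hu.mul hu).mul_left_cancel
      rw [← map_mul, ← pow_add, h3, pow_add, map_mul, mul_assoc]
      rw [show algebraMap S (Localization.Away f) (f ^ m) * E (Localization.mk a (⟨f ^ m, m, rfl⟩ : Submonoid.powers f))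
        = algebraMap S _ (D a) - Localization.mk a (⟨f ^ m, m, rfl⟩ : Submonoid.powers f) * algebraMap S _ (D (f ^ m))
        from eq_sub_of_add_eq h2, mul_sub, ← mul_assoc, h1]
      simp only [map_sub, map_mul]
  choose c hc using hmem
  refine ⟨{ toFun := c, map_add' := ?_, map_smul' := ?_, map_one_eq_zero' := ?_, leibniz' := ?_ },
    hc, fun D₂ h₂ => ?_⟩
  · intro x y
    apply val_injective
    rw [val_add, hc, hc, hc, val_add, map_add]
  · intro r x
    apply val_injective
    rw [RingHom.id_apply, val_smul, hc, hc, val_smul, Derivation.map_smul]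
  · apply val_injective
    change (c 1).val = _
    rw [hc, val_one, val_zero, Derivation.map_one_eq_zero]
  · intro x y
    apply val_injective
    change (c (x * y)).val = (x * c y + y * c x).val
    rw [val_add, val_mul, val_mul, hc, hc, hc, val_mul, Derivation.leibniz, smul_eq_mul,
      smul_eq_mul]
  · ext b
    exact (h₂ b).trans (hc b).symm

end Graded

/-! ### Symmetric squares -/

section Symmetric

variable {A A' M M' : Type*} [CommRing A] [CommRing A'] [AddCommMonoid M]
  [AddCommMonoid M'] [Module A M] [Module A' M']

variable (A M) in
/-- The symmetric square `S²_A M`: the piece of degree two of the symmetric algebra. -/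
def symSq : Submodule A (SymmetricAlgebra A M) :=
  LinearMap.range (SymmetricAlgebra.ι A M) ^ 2

/-- The map of symmetric algebras induced by a semilinear map. -/
def symMap {σ : A →+* A'} (F : M →ₛₗ[σ] M') : SymmetricAlgebra A M →+* SymmetricAlgebra A' M' :=
  letI : Algebra A (SymmetricAlgebra A' M') :=
    ((algebraMap A' (SymmetricAlgebra A' M')).comp σ).toAlgebra
  (SymmetricAlgebra.lift
    { toFun := fun m => SymmetricAlgebra.ι A' M' (F m)
      map_add' := fun x y => by rw [map_add, map_add]
      map_smul' := fun a x => by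
        rw [map_smulₛₗ, map_smul, Algebra.smul_def]; rfl :
      M →ₗ[A] SymmetricAlgebra A' M' }).toRingHom

theorem symMap_ι {σ : A →+* A'} (F : M →ₛₗ[σ] M') (m : M) :
    symMap F (SymmetricAlgebra.ι A M m) = SymmetricAlgebra.ι A' M' (F m) :=
  letI : Algebra A (SymmetricAlgebra A' M') :=
    ((algebraMap A' (SymmetricAlgebra A' M')).comp σ).toAlgebra
  SymmetricAlgebra.lift_ι_apply _ m

theorem symMap_algebraMap {σ : A →+* A'} (F : M →ₛₗ[σ] M') (a : A) :
    symMap F (algebraMap A _ a) = algebraMap A' _ (σ a) :=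
  letI : Algebra A (SymmetricAlgebra A' M') :=
    ((algebraMap A' (SymmetricAlgebra A' M')).comp σ).toAlgebra
  AlgHom.commutes (SymmetricAlgebra.lift _) a

end Symmetric

/-! ### The intersection of two quadrics -/

open MvPolynomial HomogeneousLocalization

/-- The homogeneous coordinate ring `ℂ[x₀, …, x_{n+2}]` of `ℙ^{n+2}`. -/
abbrev Poly (n : ℕ) : Type := MvPolynomial (Fin (n + 3)) ℂ

/-- The grading of `ℂ[x₀, …, x_{n+2}]` by the degree. -/
abbrev gradP (n : ℕ) : ℕ → Submodule ℂ (Poly n) := homogeneousSubmodule (Fin (n + 3)) ℂ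

instance gradP.gradedAlgebra (n : ℕ) : GradedAlgebra (gradP n) := MvPolynomial.gradedAlgebra

/-- `q₁ = ∑ x_i²`. -/
def q₁ (n : ℕ) : Poly n := ∑ i, X i ^ 2

variable {n : ℕ}

theorem X_mem_gradP (k : Fin (n + 3)) : (X k : Poly n) ∈ gradP n 1 :=
  isHomogeneous_X ℂ k

/-- `q₂ = ∑ μ_i x_i²`. -/
def q₂ (μ : Fin (n + 3) → ℂ) : Poly n := ∑ i, C (μ i) * X i ^ 2

variable (μ : Fin (n + 3) → ℂ)

/-- The ideal `(q₁, q₂)`. -/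
def idealX : Ideal (Poly n) := Ideal.span {q₁ n, q₂ μ}

theorem idealX_isHomogeneous : (idealX μ).IsHomogeneous (gradP n) := by
  refine Ideal.homogeneous_span _ _ ?_
  rintro p (rfl | rfl)
  · exact ⟨2, IsHomogeneous.sum _ _ _ fun i _ => isHomogeneous_X_pow i 2⟩
  · refine ⟨2, IsHomogeneous.sum _ _ _ fun i _ => ?_⟩
    simpa using (isHomogeneous_C (Fin (n + 3)) (μ i)).mul (isHomogeneous_X_pow i 2)

/-- The homogeneous coordinate ring `ℂ[x₀, …, x_{n+2}] / (q₁, q₂)` of `X ⊆ ℙ^{n+2}`. -/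
abbrev CoordRing : Type := Poly n ⧸ idealX μ

/-- The grading of the homogeneous coordinate ring of `X`, so that `X = Proj (gradX μ)`. -/
abbrev gradX : ℕ → Submodule ℂ (CoordRing μ) := quotGrading (gradP n) (idealX μ)

instance gradX.gradedAlgebra : GradedAlgebra (gradX μ) :=
  quotGradedAlgebra (gradP n) (idealX μ) (idealX_isHomogeneous μ)

/-- The quotient map of homogeneous coordinate rings, defining the inclusion `X ⊆ ℙ^{n+2}`. -/
def toX : gradP n →+*ᵍ gradX μ where
  __ := Ideal.Quotient.mk (idealX μ)
  map_mem := mk_mem_quotGrading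

/-- `Γ(D₊(f), 𝒪_ℙ)`, the degree zero part of `ℂ[x₀, …, x_{n+2}]_f`. -/
abbrev OP (f : Poly n) : Type := Away (gradP n) f

/-- `Γ(X ∩ D₊(f), 𝒪_X)`, the degree zero part of the localization at `f` of the coordinate ring
of `X`. -/
abbrev OX (f : Poly n) : Type := Away (gradX μ) (toX μ f)

/-- Restriction of functions from `D₊(f) ⊆ ℙ^{n+2}` to `X ∩ D₊(f)`. -/
def pullX (f : Poly n) : OP f →ₐ[ℂ] OX μ f :=
  { Away.map (toX μ) f with
    commutes' := fun _ => rfl }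

instance algebraOX (f : Poly n) : Algebra (OP f) (OX μ f) := (pullX μ f).toRingHom.toAlgebra

instance isScalarTowerOX (f : Poly n) : IsScalarTower ℂ (OP f) (OX μ f) :=
  .of_algebraMap_eq fun c => ((pullX μ f).commutes c).symm

/-- `Γ(X ∩ D₊(f), T_X)`: vector fields on `X ∩ D₊(f)`. -/
abbrev TX (f : Poly n) : Type := Derivation ℂ (OX μ f) (OX μ f)

/-- `Γ(X ∩ D₊(f), T_{ℙ|X})`: vector fields on `ℙ^{n+2}` along `X ∩ D₊(f)`, that is, homomorphisms
from `Ω_ℙ|X` to `𝒪_X`. -/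
abbrev TPX (f : Poly n) : Type := Derivation ℂ (OP f) (OX μ f)

/-- The natural map `T_X → T_{ℙ|X}` over `X ∩ D₊(f)`. -/
def tangentIncl (f : Poly n) : TX μ f →ₗ[OX μ f] TPX μ f :=
  Derivation.compAlgebraMapL ℂ (OP f) (OX μ f) (OX μ f)

/-! Restriction maps from `D₊(x_k)` to `D₊(w)`, where `w = x_k x_l`. -/

section Restriction

variable {k l : Fin (n + 3)} {w : Poly n} (hw : w = X k * X l)

/-- `Γ(D₊(x_k), 𝒪_ℙ) → Γ(D₊(w), 𝒪_ℙ)`. -/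
def resOP : OP (X k : Poly n) →ₐ[ℂ] OP w :=
  awayRes (gradP n) (X_mem_gradP l) hw

/-- `Γ(X ∩ D₊(x_k), 𝒪_X) → Γ(X ∩ D₊(w), 𝒪_X)`. -/
def resOX : OX μ (X k) →ₐ[ℂ] OX μ w :=
  awayRes (gradX μ) (Graded.map_mem (toX μ) (X_mem_gradP l)) (by rw [hw, map_mul])

theorem resOX_pullX (b : OP (X k : Poly n)) :
    resOX μ hw (algebraMap (OP (X k)) (OX μ (X k)) b) = algebraMap (OP w) (OX μ w) (resOP hw b) := by
  obtain ⟨m, a, ha, rfl⟩ := Away.mk_surjective (gradP n) (X_mem_gradP k) b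
  subst hw
  change awayMap (gradX μ) (Graded.map_mem (toX μ) (X_mem_gradP l)) (map_mul (toX μ) _ _)
      (Away.map (toX μ) _ _) =
    Away.map (toX μ) _ (awayMap (gradP n) (X_mem_gradP l) rfl _)
  simp only [Away.map_mk, awayMap_mk]
  apply val_injective
  simp only [Away.val_mk, map_mul, map_pow]

/-- `Γ(X ∩ D₊(x_k), T_X) → Γ(X ∩ D₊(w), T_X)`. -/
def resTX : TX μ (X k) →ₛₗ[(resOX μ hw).toRingHom] TX μ w :=
  restrictDer (resOX μ hw) (resOX μ hw) (fun _ => rfl)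
    (awayRes_isLocalization (gradX μ) (Graded.map_mem (toX μ) (X_mem_gradP k)) _ _ one_ne_zero)

/-- `Γ(X ∩ D₊(x_k), T_{ℙ|X}) → Γ(X ∩ D₊(w), T_{ℙ|X})`. -/
def resTPX : TPX μ (X k) →ₛₗ[(resOX μ hw).toRingHom] TPX μ w :=
  restrictDer (resOP hw) (resOX μ hw) (resOX_pullX μ hw)
    (awayRes_isLocalization (gradP n) (X_mem_gradP k) _ _ one_ne_zero)

end Restriction

/-- `H⁰(X, S² T_X)`: families of elements of `Γ(X ∩ D₊(x_k), S² T_X) = S² Γ(X ∩ D₊(x_k), T_X)`,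
`k = 0, …, n+2`, which agree on the intersections `X ∩ D₊(x_k x_l)`. -/
def H0SymSqTX : AddSubgroup ((k : Fin (n + 3)) → SymmetricAlgebra (OX μ (X k)) (TX μ (X k))) where
  carrier := {t | (∀ k, t k ∈ symSq (OX μ (X k)) (TX μ (X k))) ∧
    ∀ k l, symMap (resTX μ (w := X k * X l) rfl) (t k) =
      symMap (resTX μ (w := X k * X l) (mul_comm _ _)) (t l)}
  zero_mem' := ⟨fun _ => zero_mem _, fun _ _ => by simp only [Pi.zero_apply, map_zero]⟩
  add_mem' := fun hs ht => ⟨fun k => add_mem (hs.1 k) (ht.1 k), fun k l => by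
    simp only [Pi.add_apply, map_add, hs.2 k l, ht.2 k l]⟩
  neg_mem' := fun hs => ⟨fun k => neg_mem (hs.1 k), fun k l => by
    simp only [Pi.neg_apply, map_neg, hs.2 k l]⟩

/-- `H⁰(X, S² T_{ℙ|X})`, defined in the same way. -/
def H0SymSqTPX :
    AddSubgroup ((k : Fin (n + 3)) → SymmetricAlgebra (OX μ (X k)) (TPX μ (X k))) where
  carrier := {t | (∀ k, t k ∈ symSq (OX μ (X k)) (TPX μ (X k))) ∧
    ∀ k l, symMap (resTPX μ (w := X k * X l) rfl) (t k) =
      symMap (resTPX μ (w := X k * X l) (mul_comm _ _)) (t l)}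
  zero_mem' := ⟨fun _ => zero_mem _, fun _ _ => by simp only [Pi.zero_apply, map_zero]⟩
  add_mem' := fun hs ht => ⟨fun k => add_mem (hs.1 k) (ht.1 k), fun k l => by
    simp only [Pi.add_apply, map_add, hs.2 k l, ht.2 k l]⟩
  neg_mem' := fun hs => ⟨fun k => neg_mem (hs.1 k), fun k l => by
    simp only [Pi.neg_apply, map_neg, hs.2 k l]⟩

/-- The map `S² T_X → S² T_{ℙ|X}`, on families of local sections. -/
def symSqIncl (t : (k : Fin (n + 3)) → SymmetricAlgebra (OX μ (X k)) (TX μ (X k))) :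
    (k : Fin (n + 3)) → SymmetricAlgebra (OX μ (X k)) (TPX μ (X k)) :=
  fun k => symMap (tangentIncl μ (X k)) (t k)

/-! ### The quadratic vector fields -/

/-- The derivation `x_i ∂_j - x_j ∂_i` of `ℂ[x₀, …, x_{n+2}]`. -/
def rotPoly (i j : Fin (n + 3)) : Derivation ℂ (Poly n) (Poly n) :=
  (X i : Poly n) • pderiv j - (X j : Poly n) • pderiv i

theorem rotPoly_mem (i j : Fin (n + 3)) (d : ℕ) (a : Poly n) (ha : a ∈ gradP n d) :
    rotPoly i j a ∈ gradP n d := by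
  have key : ∀ p q : Fin (n + 3), (X p : Poly n) * pderiv q a ∈ gradP n d := by
    intro p q
    rcases Nat.eq_zero_or_pos d with rfl | hd
    · have h0 : a = C (coeff 0 a) := (totalDegree_eq_zero_iff_eq_C).1
        ((totalDegree_zero_iff_isHomogeneous _).2 ha)
      rw [h0, pderiv_C, mul_zero]
      exact zero_mem _
    · have h1 : (X p * pderiv q a).IsHomogeneous (1 + (d - 1)) :=
        (isHomogeneous_X ℂ p).mul (IsHomogeneous.pderiv ha)
      rwa [Nat.add_sub_cancel' hd] at h1
  exact sub_mem (key i j) (key j i)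

/-- The vector field `x_i ∂_j - x_j ∂_i` on the open subset `D₊(x_k)` of `ℙ^{n+2}`: the restriction
to the degree zero part of the extension of the above derivation to `ℂ[x₀, …, x_{n+2}]_{x_k}`. -/
def rotP (i j k : Fin (n + 3)) : Derivation ℂ (OP (X k : Poly n)) (OP (X k : Poly n)) :=
  (existsUnique_away (gradP n) (rotPoly i j) (rotPoly_mem i j) (X_mem_gradP k)).choose

/-- The restriction of the vector field `x_i ∂_j - x_j ∂_i` to `X ∩ D₊(x_k)`, a section of
`T_{ℙ|X}`. -/
def rot (i j k : Fin (n + 3)) : TPX μ (X k) :=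
  (Algebra.linearMap (OP (X k)) (OX μ (X k))).compDer (rotP i j k)

/-- The quadratic vector field `s_i = ∑_{j ≠ i} (x_i ∂_j - x_j ∂_i)² / (μ_j - μ_i)`, given by its
restrictions to the open sets `X ∩ D₊(x_k)`. -/
def quadField (i : Fin (n + 3)) : (k : Fin (n + 3)) → SymmetricAlgebra (OX μ (X k)) (TPX μ (X k)) :=
  fun k => ∑ j ∈ Finset.univ.erase i,
    algebraMap ℂ (OX μ (X k)) (1 / (μ j - μ i)) •
      SymmetricAlgebra.ι (OX μ (X k)) (TPX μ (X k)) (rot μ i j k) ^ 2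

end TwoQuadrics

end

/-!
The reason why `s_i` comes from `S² T_X` is that its contractions with both equations of `X` vanish
along `X`. The field `x_i ∂_j - x_j ∂_i` annihilates `q₁`, and maps `q₂` to
`2 (μ_j - μ_i) x_i x_j`, which cancels the denominator in `s_i`. The contraction with `q₂` is thus,
up to a constant, `∑_{j ≠ i} x_i x_j (x_i ∂_j - x_j ∂_i) = x_i² E - x_i q₁ ∂_i` with `E` the Euler
field, and this is zero in `T_{ℙ|X}` (`sum_ratio_smul_rot`, `sum_contract_rot`).

To pass from vanishing contractions to an actual lift, each chart `X ∩ D₊(x_k)` is given an explicit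
field `v` (`normalField`), a combination of the `x_k ∂_b - x_b ∂_k`, which annihilates the first
equation and has derivative `1` on the second; the coefficients are the multiples of `x_b / x_k` for
which this derivative becomes `-∑_{b ≠ k} (x_b / x_k)² = 1`, and they make sense because the `μ_b`
are distinct. Subtracting from `r_j = x_i ∂_j - x_j ∂_i` the multiple `a_j v`, where `a_j` is the
derivative of the second equation along `r_j`, gives a field annihilating both equations, hence a
vector field `τ_j` on `X` (`exists_tangentIncl_eq`, `tangentRot`). As `∑ c_j a_j r_j = 0` and `∑ c_j a_j² = 0`
for the coefficients `c_j` of `s_i`, the expression `∑ c_j τ_j²` maps to `∑ c_j r_j² = s_i`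
(`sum_smul_ι_sq_translate`, `symSqIncl_liftQuadField`).

On an overlap of two charts, the two choices of `v`, scaled to the same equation, differ by a field
tangent to `X` (`exists_normalField_eq_tangentIncl_add`). The two families `τ_j` therefore differ by
`a_j δ` with `δ` tangent to `X`, and the same two relations show that the lifts agree there
(`symMap_resTX_liftQuadField`). The injectivity of `S² T_X → S² T_{ℙ|X}` is not needed.
-/

noncomputable section

namespace TwoQuadrics

open MvPolynomial HomogeneousLocalization

/-! ### Derivations and localization -/

section Restrict

variable {K B A B' A' : Type*} [CommRing K] [CommRing B] [CommRing A] [CommRing B'] [CommRing A']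
  [Algebra K B] [Algebra K A] [Algebra K B'] [Algebra K A'] [Algebra B A] [Algebra B' A']

theorem restrictDer_eq_of_comp (ρ : B →ₐ[K] B') (σ : A →ₐ[K] A')
    (hcomm : ∀ b, σ (algebraMap B A b) = algebraMap B' A' (ρ b))
    [IsScalarTower K B' A']
    (hloc : ∃ r : B, @IsLocalization.Away B _ r B' _ ρ.toRingHom.toAlgebra)
    {D : Derivation K B A} {E : Derivation K B' A'} (h : ∀ b, E (ρ b) = σ (D b)) :
    restrictDer ρ σ hcomm hloc D = E :=
  (existsUnique_restrict ρ σ hcomm hloc D).unique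
    (restrictDer_apply ρ σ hcomm hloc D) h

/-- The quotient rule, with denominators cleared. -/
theorem sq_mul_derivation_apply_of_mul_eq {S L : Type*} [CommRing S] [CommRing L] [Algebra K S]
    [Algebra K L] [Algebra S L] (D : Derivation K S S) (E : Derivation K L L)
    (hE : ∀ a, E (algebraMap S L a) = algebraMap S L (D a)) {g a : S} {x : L}
    (h : algebraMap S L g * x = algebraMap S L a) :
    algebraMap S L (g * g) * E x = algebraMap S L (g * D a - a * D g) := by
  have h2 := congrArg E h
  rw [Derivation.leibniz, hE, hE, smul_eq_mul, smul_eq_mul] at h2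
  rw [map_mul, map_sub, map_mul, map_mul, ← h2, ← h]
  ring

end Restrict

theorem sum_derivation_apply {R A M J : Type*} [CommSemiring R] [CommSemiring A]
    [AddCommMonoid M] [Algebra R A] [Module A M] [Module R M] (s : Finset J)
    (D : J → Derivation R A M) (a : A) : (∑ j ∈ s, D j) a = ∑ j ∈ s, D j a :=
  map_sum (⟨⟨fun D => D a, rfl⟩, fun _ _ => rfl⟩ : Derivation R A M →+ M) D s

theorem mul_sum_eq_sum_add {A J : Type*} [CommRing A] (s : Finset J) (u v : A) (f t c : J → A)
    (h : ∀ j ∈ s, u * f j = t j + c j * v) (hc : ∑ j ∈ s, c j = 1) :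
    u * ∑ j ∈ s, f j = ∑ j ∈ s, t j + v := by
  rw [← one_mul v, ← hc, Finset.mul_sum, Finset.sum_mul, ← Finset.sum_add_distrib]
  exact Finset.sum_congr rfl h

section Graded

variable {K S : Type*} [CommRing K] [CommRing S] [Algebra K S]
  (𝒜 : ℕ → Submodule K S) [GradedAlgebra 𝒜]

theorem algebraMap_pow_mul_val_mk {f : S} {d : ℕ} (hf : f ∈ 𝒜 d) (m : ℕ) (a : S)
    (ha : a ∈ 𝒜 (m • d)) :
    algebraMap S (Localization.Away f) (f ^ m) * (Away.mk 𝒜 hf m a ha).val =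
      algebraMap S _ a := by
  rw [Away.val_mk, mul_comm, Localization.mk_eq_mk']
  exact IsLocalization.mk'_spec _ a (⟨f ^ m, m, rfl⟩ : Submonoid.powers f)

theorem isUnit_algebraMap_pow (f : S) (m : ℕ) :
    IsUnit (algebraMap S (Localization.Away f) (f ^ m)) :=
  IsLocalization.map_units (Localization.Away f) (⟨f ^ m, m, rfl⟩ : Submonoid.powers f)

theorem away_ext (ℬ : ℕ → Submodule K S) {f : S} {x y : Away ℬ f} (m : ℕ)
    (h : algebraMap S (Localization.Away f) (f ^ m) * x.val =
      algebraMap S (Localization.Away f) (f ^ m) * y.val) : x = y :=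
  val_injective _ ((isUnit_algebraMap_pow f m).mul_left_cancel h)

/-- The derivation of `S_(f)` induced by a derivation of `S` which preserves degrees. -/
def awayDer (D : Derivation K S S) (hD : ∀ d, ∀ a ∈ 𝒜 d, D a ∈ 𝒜 d)
    {f : S} {d : ℕ} (hf : f ∈ 𝒜 d) : Derivation K (Away 𝒜 f) (Away 𝒜 f) :=
  (existsUnique_away 𝒜 D hD hf).choose

/-- The quotient rule for the derivation induced on `S_(f)`. -/
theorem awayDer_mk (D : Derivation K S S) (hD : ∀ d, ∀ a ∈ 𝒜 d, D a ∈ 𝒜 d)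
    {f : S} {d : ℕ} (hf : f ∈ 𝒜 d) (m : ℕ) (a : S) (ha : a ∈ 𝒜 (m • d)) :
    awayDer 𝒜 D hD hf (Away.mk 𝒜 hf m a ha) =
      Away.mk 𝒜 hf (m + m) (f ^ m * D a - a * D (f ^ m)) (by
        rw [add_smul]
        exact sub_mem (SetLike.mul_mem_graded (SetLike.pow_mem_graded m hf) (hD _ _ ha))
          (SetLike.mul_mem_graded ha (hD _ _ (SetLike.pow_mem_graded m hf)))) := by
  apply away_ext 𝒜 (m + m)
  rw [algebraMap_pow_mul_val_mk, awayDer, (existsUnique_away 𝒜 D hD hf).choose_spec.1, pow_add]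
  exact sq_mul_derivation_apply_of_mul_eq D _ (existsUnique_extend D f).choose_spec.1
    (algebraMap_pow_mul_val_mk 𝒜 hf m a ha)

theorem awayRes_mk {f g w : S} {d e : ℕ} (hf : f ∈ 𝒜 d) (hg : g ∈ 𝒜 e) (hw : w = f * g)
    (m : ℕ) (a : S) (ha : a ∈ 𝒜 (m • d)) (hw' : w ∈ 𝒜 (d + e)) :
    awayRes 𝒜 hg hw (Away.mk 𝒜 hf m a ha) =
      Away.mk 𝒜 hw' m (a * g ^ m) (by
        rw [smul_add]; exact SetLike.mul_mem_graded ha (SetLike.pow_mem_graded _ hg)) :=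
  awayMap_mk 𝒜 hg hw m hf a ha

/-- The derivations induced by `D` on `S_(f)` and on `S_(fg)` are compatible. -/
theorem awayDer_awayRes (D : Derivation K S S) (hD : ∀ d, ∀ a ∈ 𝒜 d, D a ∈ 𝒜 d)
    {f g w : S} {d e : ℕ} (hf : f ∈ 𝒜 d) (hg : g ∈ 𝒜 e) (hw : w = f * g) (hw' : w ∈ 𝒜 (d + e))
    (b : Away 𝒜 f) :
    awayDer 𝒜 D hD hw' (awayRes 𝒜 hg hw b) = awayRes 𝒜 hg hw (awayDer 𝒜 D hD hf b) := by
  obtain ⟨m, a, ha, rfl⟩ := Away.mk_surjective 𝒜 hf b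
  rw [awayRes_mk 𝒜 hf hg hw m a ha hw', awayDer_mk, awayDer_mk, awayRes_mk 𝒜 hf hg hw _ _ _ hw']
  congr 1
  simp only [hw, mul_pow, Derivation.leibniz, smul_eq_mul, pow_add]
  ring

end Graded

/-! ### Symmetric squares -/

section Symmetric

variable {A A' M M' : Type*} [CommRing A] [CommRing A'] [AddCommMonoid M]
  [AddCommMonoid M'] [Module A M] [Module A' M']
  {M₂ : Type*} [AddCommMonoid M₂] [Module A M₂]

theorem sum_smul_ι_sq_mem_symSq {J : Type*} (s : Finset J) (c : J → A) (r : J → M) :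
    ∑ j ∈ s, c j • SymmetricAlgebra.ι A M (r j) ^ 2 ∈ symSq A M :=
  sum_mem fun _ _ => Submodule.smul_mem _ _
    (Submodule.pow_mem_pow _ (LinearMap.mem_range_self _ _) 2)

theorem symMap_sum_smul_ι_sq {σ : A →+* A'} (F : M →ₛₗ[σ] M') {J : Type*} (s : Finset J)
    (c : J → A) (r : J → M) :
    symMap F (∑ j ∈ s, c j • SymmetricAlgebra.ι A M (r j) ^ 2) =
      ∑ j ∈ s, σ (c j) • SymmetricAlgebra.ι A' M' (F (r j)) ^ 2 := by
  rw [map_sum]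
  refine Finset.sum_congr rfl fun j _ => ?_
  rw [Algebra.smul_def, Algebra.smul_def, map_mul, map_pow, symMap_ι, symMap_algebraMap]

/-- A quadratic expression `∑ c_j r_j²` is unchanged when each `r_j` is translated by `a_j • v`, as
soon as the contraction `∑ c_j a_j r_j` and the double contraction `∑ c_j a_j²` vanish. -/
theorem sum_smul_ι_sq_translate {J : Type*}
    (s : Finset J) (c a : J → A) (r r' : J → M) (v : M)
    (hr : ∀ j ∈ s, r' j = r j + a j • v) (h₁ : ∑ j ∈ s, (c j * a j) • r j = 0)
    (h₂ : ∑ j ∈ s, c j * a j * a j = 0) :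
    ∑ j ∈ s, c j • SymmetricAlgebra.ι A M (r' j) ^ 2 =
      ∑ j ∈ s, c j • SymmetricAlgebra.ι A M (r j) ^ 2 := by
  set ι := SymmetricAlgebra.ι A M
  have h₁' : ∑ j ∈ s, algebraMap A (SymmetricAlgebra A M) (c j * a j) * ι (r j) = 0 := by
    rw [← map_zero ι, ← h₁, map_sum]
    exact Finset.sum_congr rfl fun j _ => by rw [map_smul, Algebra.smul_def]
  have h₂' : ∑ j ∈ s, algebraMap A (SymmetricAlgebra A M) (c j * a j * a j) = 0 := by
    rw [← map_sum, h₂, map_zero]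
  have : ∀ j ∈ s, c j • ι (r' j) ^ 2 = c j • ι (r j) ^ 2 +
      (2 * ι v * (algebraMap A (SymmetricAlgebra A M) (c j * a j) * ι (r j)) +
        ι v ^ 2 * algebraMap A (SymmetricAlgebra A M) (c j * a j * a j)) := fun j hj => by
    rw [hr j hj, map_add, map_smul, Algebra.smul_def, Algebra.smul_def, Algebra.smul_def, map_mul,
      map_mul, map_mul]
    ring
  rw [Finset.sum_congr rfl this, Finset.sum_add_distrib, Finset.sum_add_distrib, ← Finset.mul_sum,
    ← Finset.mul_sum, h₁', h₂', mul_zero, mul_zero, add_zero, add_zero]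

/-- A quadratic expression in the elements `F (r_j) + a_j • v` comes from the symmetric square of
the source of `F`, as soon as its contractions along `a` vanish. -/
theorem symMap_sum_smul_ι_sq_eq (F : M →ₗ[A] M₂) {J : Type*}
    (s : Finset J) (c a : J → A) (r : J → M) (r' : J → M₂) (v : M₂)
    (hr : ∀ j ∈ s, r' j = F (r j) + a j • v) (h₁ : ∑ j ∈ s, (c j * a j) • r j = 0)
    (h₂ : ∑ j ∈ s, c j * a j * a j = 0) :
    symMap F (∑ j ∈ s, c j • SymmetricAlgebra.ι A M (r j) ^ 2) =
      ∑ j ∈ s, c j • SymmetricAlgebra.ι A M₂ (r' j) ^ 2 := by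
  rw [symMap_sum_smul_ι_sq]
  refine (sum_smul_ι_sq_translate s c a _ _ v hr ?_ h₂).symm
  rw [← map_zero F, ← h₁, map_sum]
  exact Finset.sum_congr rfl fun j _ => (map_smul F _ _).symm

end Symmetric

/-! ### Charts of the intersection of two quadrics -/

variable {n : ℕ} (μ : Fin (n + 3) → ℂ)

theorem q₁_mem : q₁ n ∈ gradP n (2 • 1) :=
  IsHomogeneous.sum _ _ _ fun i _ => isHomogeneous_X_pow i 2

theorem q₂_mem : q₂ μ ∈ gradP n (2 • 1) :=
  IsHomogeneous.sum _ _ _ fun i _ => by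
    simpa using (isHomogeneous_C (Fin (n + 3)) (μ i)).mul (isHomogeneous_X_pow i 2)

theorem pullX_mk {f : Poly n} {d : ℕ} (hf : f ∈ gradP n d) (m : ℕ) (a : Poly n)
    (ha : a ∈ gradP n (m • d)) :
    pullX μ f (Away.mk (gradP n) hf m a ha) =
      Away.mk (gradX μ) (Graded.map_mem (toX μ) hf) m (toX μ a)
        (Graded.map_mem (toX μ) ha) :=
  Away.map_mk (toX μ) f hf m a ha

theorem pullX_surjective {f : Poly n} {d : ℕ} (hf : f ∈ gradP n d) :
    Function.Surjective (pullX μ f) := by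
  intro b
  obtain ⟨m, _, ⟨a, ha, rfl⟩, rfl⟩ := Away.mk_surjective (gradX μ) (Graded.map_mem (toX μ) hf) b
  exact ⟨_, pullX_mk μ hf m a ha⟩

theorem tangentIncl_injective {f : Poly n} {d : ℕ} (hf : f ∈ gradP n d) :
    Function.Injective (tangentIncl μ f) := by
  intro D E h
  refine Derivation.ext fun b => ?_
  obtain ⟨a, rfl⟩ := pullX_surjective μ hf b
  exact congrArg (fun F => F a) h

/-- The map `ℂ[x₀, …, x_{n+2}] → (ℂ[x₀, …, x_{n+2}] / (q₁, q₂))_{f}`. -/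
def toLoc (f : Poly n) : Poly n →+* Localization.Away (toX μ f) :=
  (algebraMap (CoordRing μ) _).comp (Ideal.Quotient.mk (idealX μ))

theorem toLoc_eq_zero (f : Poly n) {a : Poly n} (ha : a ∈ idealX μ) : toLoc μ f a = 0 := by
  rw [toLoc, RingHom.comp_apply, Ideal.Quotient.eq_zero_iff_mem.2 ha, map_zero]

theorem toLoc_pow_mul_val {f : Poly n} {d : ℕ} (hf : f ∈ gradP n d) (m : ℕ) (a : Poly n)
    (ha : a ∈ gradP n (m • d)) :
    toLoc μ f f ^ m * (pullX μ f (Away.mk (gradP n) hf m a ha)).val = toLoc μ f a := by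
  rw [pullX_mk, ← map_pow]
  exact algebraMap_pow_mul_val_mk (gradX μ) (Graded.map_mem (toX μ) hf) m _ _

theorem isUnit_toLoc (f : Poly n) : IsUnit (toLoc μ f f) := by
  simpa using! isUnit_algebraMap_pow (toX μ f) 1

theorem q₁_mem_idealX : q₁ n ∈ idealX μ := Ideal.subset_span (by simp)

theorem q₂_mem_idealX : q₂ μ ∈ idealX μ := Ideal.subset_span (by simp)

/-! ### Functions on the charts of `X` -/

/-- The inclusion of `Γ(X ∩ D₊(f), 𝒪_X)` into the localization of the coordinate ring at `f`. -/
def valOX (f : Poly n) : OX μ f →+* Localization.Away (toX μ f) := algebraMap _ _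

/-- The function `x_p / x_k` on `D₊(x_k)`. -/
def ratioP (k p : Fin (n + 3)) : OP (X k : Poly n) :=
  Away.mk (gradP n) (X_mem_gradP k) 1 (X p) (by simpa using X_mem_gradP p)

/-- The function `x_p / x_k` on `X ∩ D₊(x_k)`. -/
def ratio (k p : Fin (n + 3)) : OX μ (X k) := pullX μ (X k) (ratioP k p)

theorem valOX_algebraMap (f : Poly n) (c : ℂ) :
    valOX μ f (algebraMap ℂ (OX μ f) c) = toLoc μ f (C c) := by
  change (algebraMap ℂ (OX μ f) c).val = _
  rw [val_algebraMap_away, IsScalarTower.algebraMap_apply ℂ (CoordRing μ)]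
  rfl

theorem toLoc_mul_ratio (k p : Fin (n + 3)) :
    toLoc μ (X k) (X k) * valOX μ (X k) (ratio μ k p) = toLoc μ (X k) (X p) := by
  have := toLoc_pow_mul_val μ (X_mem_gradP k) 1 (X p) (by simpa using X_mem_gradP p)
  rwa [pow_one] at this

theorem OX_ext {f : Poly n} (m : ℕ) {x y : OX μ f}
    (h : toLoc μ f f ^ m * valOX μ f x = toLoc μ f f ^ m * valOX μ f y) : x = y :=
  val_injective _ (((isUnit_toLoc μ f).pow m).mul_left_cancel h)

theorem ratio_self (k : Fin (n + 3)) : ratio μ k k = 1 := by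
  apply OX_ext μ 1
  rw [pow_one, toLoc_mul_ratio, map_one, mul_one]

theorem sum_ratio_sq (k : Fin (n + 3)) : ∑ p, ratio μ k p ^ 2 = 0 := by
  apply OX_ext μ 2
  rw [map_zero, mul_zero, map_sum, Finset.mul_sum, ← toLoc_eq_zero μ (X k) (q₁_mem_idealX μ), q₁,
    map_sum]
  refine Finset.sum_congr rfl fun p _ => ?_
  rw [map_pow, ← mul_pow, toLoc_mul_ratio, map_pow]

theorem sum_mul_ratio_sq (k : Fin (n + 3)) :
    ∑ p, algebraMap ℂ (OX μ (X k)) (μ p) * ratio μ k p ^ 2 = 0 := by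
  apply OX_ext μ 2
  rw [map_zero, mul_zero, map_sum, Finset.mul_sum, ← toLoc_eq_zero μ (X k) (q₂_mem_idealX μ), q₂,
    map_sum]
  refine Finset.sum_congr rfl fun p _ => ?_
  rw [map_mul, map_mul, map_pow, map_pow, ← toLoc_mul_ratio μ k p, valOX_algebraMap]
  ring

/-! ### The vector fields `x_i ∂_j - x_j ∂_i` -/

theorem rotPoly_apply (i j : Fin (n + 3)) (a : Poly n) :
    rotPoly i j a = X i * pderiv j a - X j * pderiv i a := rfl

theorem pderiv_sum_C_mul_X_sq (c : Fin (n + 3) → ℂ) (j : Fin (n + 3)) :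
    pderiv j (∑ i, C (c i) * X i ^ 2 : Poly n) = C (2 * c j) * X j := by
  rw [map_sum, Finset.sum_eq_single j]
  · rw [pderiv_C_mul, pderiv_pow, pderiv_X_self, map_mul, map_ofNat]
    simp only [Nat.cast_ofNat, Nat.add_one_sub_one, pow_one, mul_one]
    ring
  · intro b _ hb
    rw [pderiv_C_mul, pderiv_pow, pderiv_X_of_ne hb, mul_zero, mul_zero]
  · simp

theorem rotPoly_q₂ (i j : Fin (n + 3)) :
    rotPoly i j (q₂ μ) = C (2 * (μ j - μ i)) * (X i * X j) := by
  rw [rotPoly_apply, q₂, pderiv_sum_C_mul_X_sq, pderiv_sum_C_mul_X_sq, mul_sub, map_sub]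
  ring

theorem rotPoly_q₁ (i j : Fin (n + 3)) : rotPoly i j (q₁ n) = 0 := by
  have : q₁ n = q₂ fun _ => 1 := by simp [q₁, q₂]
  rw [this, rotPoly_q₂, sub_self, mul_zero, map_zero, zero_mul]

/-- The identity `∑_{j ≠ i} x_i x_j (x_i ∂_j - x_j ∂_i) = x_i² E - x_i q₁ ∂_i`, where `E` is the
Euler field, evaluated on the quotient `a / F` of two homogeneous polynomials of the same degree.
The Euler field contributes nothing. -/
theorem sum_mul_rotPoly (i : Fin (n + 3)) {m : ℕ} {a F : Poly n} (ha : a.IsHomogeneous m)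
    (hF : F.IsHomogeneous m) :
    ∑ j ∈ Finset.univ.erase i, X i * X j * (F * rotPoly i j a - a * rotPoly i j F) =
      -(X i * (F * pderiv i a - a * pderiv i F)) * q₁ n := by
  -- The summand with `j = i` is zero, so it may be added.
  have hi : (X i : Poly n) * X i * (F * rotPoly i i a - a * rotPoly i i F) = 0 := by
    rw [rotPoly_apply, rotPoly_apply]; ring
  rw [Finset.sum_erase (f := fun j => X i * X j * (F * rotPoly i j a - a * rotPoly i j F)) _ hi]
  have : ∀ j, (X i : Poly n) * X j * (F * rotPoly i j a - a * rotPoly i j F) =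
      X i ^ 2 * F * (X j * pderiv j a) - X i ^ 2 * a * (X j * pderiv j F) -
        (X i * (F * pderiv i a - a * pderiv i F)) * X j ^ 2 := fun j => by
    rw [rotPoly_apply, rotPoly_apply]; ring
  rw [Finset.sum_congr rfl fun j _ => this j, Finset.sum_sub_distrib, Finset.sum_sub_distrib,
    ← Finset.mul_sum, ← Finset.mul_sum, ← Finset.mul_sum, ha.sum_X_mul_pderiv, hF.sum_X_mul_pderiv,
    q₁]
  simp only [nsmul_eq_mul]
  ring

/-- The quotient rule for the vector field `x_i ∂_j - x_j ∂_i` on `X ∩ D₊(x_k)`. -/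
theorem toLoc_pow_mul_rot (i j k : Fin (n + 3)) (m : ℕ) (a : Poly n) (ha : a ∈ gradP n (m • 1)) :
    toLoc μ (X k) (X k) ^ (m + m) *
        valOX μ (X k) (rot μ i j k (Away.mk (gradP n) (X_mem_gradP k) m a ha)) =
      toLoc μ (X k) (X k ^ m * rotPoly i j a - a * rotPoly i j (X k ^ m)) := by
  have h := awayDer_mk (gradP n) (rotPoly i j) (rotPoly_mem i j) (X_mem_gradP k) m a ha
  change _ * valOX μ (X k) (pullX μ (X k) (awayDer (gradP n) (rotPoly i j) (rotPoly_mem i j)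
    (X_mem_gradP k) (Away.mk (gradP n) (X_mem_gradP k) m a ha))) = _
  rw [h]
  exact toLoc_pow_mul_val μ (X_mem_gradP k) (m + m) _ _

/-- The relation `∑_{j ≠ i} x_i x_j (x_i ∂_j - x_j ∂_i) = 0` between vector fields along `X`: by
`sum_mul_rotPoly` the left side is a multiple of `q₁`, up to the Euler field, which is zero on
`ℙ^{n+2}`. -/
theorem sum_ratio_smul_rot (i k : Fin (n + 3)) :
    ∑ j ∈ Finset.univ.erase i, (ratio μ k i * ratio μ k j) • rot μ i j k = 0 := by
  refine Derivation.ext fun b => ?_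
  obtain ⟨m, a, ha, rfl⟩ := Away.mk_surjective (gradP n) (X_mem_gradP k) b
  apply OX_ext μ (2 + (m + m))
  have hs := sum_mul_rotPoly i (m := m) (a := a) (F := X k ^ m) (by simpa using ha)
    (isHomogeneous_X_pow k m)
  have h0 := toLoc_eq_zero μ (X k) (Ideal.mul_mem_left (idealX μ)
    (-(X i * (X k ^ m * pderiv i a - a * pderiv i (X k ^ m)))) (q₁_mem_idealX μ))
  rw [Derivation.zero_apply, map_zero, mul_zero, ← h0, ← hs, map_sum, sum_derivation_apply,
    map_sum, Finset.mul_sum]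
  refine Finset.sum_congr rfl fun j _ => ?_
  rw [Derivation.smul_apply, smul_eq_mul, map_mul, map_mul, map_mul (toLoc μ (X k)),
    ← toLoc_pow_mul_rot μ i j k m a ha, map_mul (toLoc μ (X k)), ← toLoc_mul_ratio μ k i,
    ← toLoc_mul_ratio μ k j]
  ring

/-- The function `q₁ / x_k²` on `D₊(x_k)`, a local equation of the first quadric. -/
def eqn₁ (k : Fin (n + 3)) : OP (X k : Poly n) :=
  Away.mk (gradP n) (X_mem_gradP k) 2 (q₁ n) q₁_mem

/-- The function `q₂ / x_k²` on `D₊(x_k)`, a local equation of the second quadric. -/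
def eqn₂ (k : Fin (n + 3)) : OP (X k : Poly n) :=
  Away.mk (gradP n) (X_mem_gradP k) 2 (q₂ μ) (q₂_mem μ)

theorem pullX_eqn₁ (k : Fin (n + 3)) : pullX μ (X k) (eqn₁ k) = 0 := by
  apply OX_ext μ 2
  rw [map_zero, mul_zero]
  exact (toLoc_pow_mul_val μ (X_mem_gradP k) 2 _ _).trans
    (toLoc_eq_zero μ (X k) (q₁_mem_idealX μ))

theorem pullX_eqn₂ (k : Fin (n + 3)) : pullX μ (X k) (eqn₂ μ k) = 0 := by
  apply OX_ext μ 2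
  rw [map_zero, mul_zero]
  exact (toLoc_pow_mul_val μ (X_mem_gradP k) 2 _ _).trans
    (toLoc_eq_zero μ (X k) (q₂_mem_idealX μ))

theorem rot_eqn₁ (i j k : Fin (n + 3)) : rot μ i j k (eqn₁ k) = 0 := by
  apply OX_ext μ (2 + 2)
  rw [eqn₁, toLoc_pow_mul_rot, rotPoly_q₁, mul_zero, zero_sub, map_zero, mul_zero]
  exact toLoc_eq_zero μ _ (neg_mem (Ideal.mul_mem_right _ _ (q₁_mem_idealX μ)))

theorem rot_eqn₂ (i j k : Fin (n + 3)) : rot μ i j k (eqn₂ μ k) =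
    algebraMap ℂ (OX μ (X k)) (2 * (μ j - μ i)) * (ratio μ k i * ratio μ k j) := by
  apply OX_ext μ (2 + 2)
  rw [eqn₂, toLoc_pow_mul_rot, rotPoly_q₂, map_sub,
    toLoc_eq_zero μ _ (Ideal.mul_mem_right _ _ (q₂_mem_idealX μ)), sub_zero]
  simp only [map_mul (valOX μ (X k)), map_mul (toLoc μ (X k)), map_pow, valOX_algebraMap]
  rw [← toLoc_mul_ratio μ k i, ← toLoc_mul_ratio μ k j]
  ring

/-! ### Vector fields tangent to `X` -/

/-- The kernel of restriction to `X ∩ D₊(x_k)` is generated by the two local equations. -/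
theorem mem_span_of_pullX_eq_zero (k : Fin (n + 3)) {b : OP (X k : Poly n)}
    (hb : pullX μ (X k) b = 0) : ∃ g₁ g₂, b = g₁ * eqn₁ k + g₂ * eqn₂ μ k := by
  obtain ⟨m, a, ha, rfl⟩ := Away.mk_surjective (gradP n) (X_mem_gradP k) b
  have h0 : toLoc μ (X k) a = 0 := by
    rw [← toLoc_pow_mul_val μ (X_mem_gradP k) m a ha, hb, val_zero, mul_zero]
  obtain ⟨⟨_, N, rfl⟩, hN⟩ := (IsLocalization.map_eq_zero_iff (Submonoid.powers (toX μ (X k)))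
    (Localization.Away (toX μ (X k))) (Ideal.Quotient.mk (idealX μ) a)).1 h0
  have hN' : (X k : Poly n) ^ N * a ∈ idealX μ :=
    Ideal.Quotient.eq_zero_iff_mem.1 (by rw [map_mul, map_pow]; exact hN)
  obtain ⟨G₁, G₂, hG⟩ := Ideal.mem_span_pair.1 hN'
  -- The polynomials `G₁`, `G₂` need not be homogeneous. They are replaced by the homogeneous parts
  -- that contribute to `x_k^(N + 2) a = x_k² G₁ q₁ + x_k² G₂ q₂`; multiplying by `x_k²` ensures
  -- that the degree `N + m + 2` of the left side is at least the degree of the equations.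
  let H (G : Poly n) : Poly n := DirectSum.decompose (gradP n) (X k ^ 2 * G) (N + m)
  have hH : ∀ G, H G ∈ gradP n ((N + m) • 1) := fun G => by
    rw [smul_eq_mul, mul_one]; exact SetLike.coe_mem _
  have hmul : ∀ G q, q ∈ gradP n 2 →
      (DirectSum.decompose (gradP n) (X k ^ 2 * G * q) (N + m + 2) : Poly n) = H G * q :=
    fun G q hq => DirectSum.coe_decompose_mul_add_of_right_mem (gradP n) hq
  have hdeg : (X k : Poly n) ^ (N + 2) * a ∈ gradP n (N + m + 2) := by
    have := SetLike.mul_mem_graded (SetLike.pow_mem_graded (N + 2) (X_mem_gradP k)) ha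
    convert this using 2
    simp only [smul_eq_mul]; ring
  have key : (X k : Poly n) ^ (N + 2) * a = H G₁ * q₁ n + H G₂ * q₂ μ := by
    rw [← hmul _ _ q₁_mem, ← hmul _ _ (q₂_mem μ), ← Submodule.coe_add, ← DirectSum.add_apply,
      ← DirectSum.decompose_add, ← DirectSum.decompose_of_mem_same (gradP n) hdeg]
    congr 3
    rw [pow_add, mul_right_comm, ← hG]
    ring
  refine ⟨Away.mk (gradP n) (X_mem_gradP k) (N + m) (H G₁) (hH _),
    Away.mk (gradP n) (X_mem_gradP k) (N + m) (H G₂) (hH _), ?_⟩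
  apply away_ext (gradP n) (N + 2 + m)
  have e := congrArg (algebraMap (Poly n) (Localization.Away (X k : Poly n))) key
  rw [map_mul, map_add, map_mul, map_mul,
    ← algebraMap_pow_mul_val_mk (gradP n) (X_mem_gradP k) m a ha,
    ← algebraMap_pow_mul_val_mk (gradP n) (X_mem_gradP k) (N + m) (H G₁) (hH _),
    ← algebraMap_pow_mul_val_mk (gradP n) (X_mem_gradP k) (N + m) (H G₂) (hH _),
    ← algebraMap_pow_mul_val_mk (gradP n) (X_mem_gradP k) 2 _ q₁_mem,
    ← algebraMap_pow_mul_val_mk (gradP n) (X_mem_gradP k) 2 _ (q₂_mem μ)] at e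
  rw [pow_add _ _ m, map_mul, mul_assoc, e, val_add, val_mul, val_mul, eqn₁, eqn₂]
  simp only [map_pow]
  ring

/-- A vector field along `X ∩ D₊(x_k)` which annihilates both equations of `X` is tangent
to `X`. -/
theorem exists_tangentIncl_eq (k : Fin (n + 3)) (D : TPX μ (X k)) (h₁ : D (eqn₁ k) = 0)
    (h₂ : D (eqn₂ μ k) = 0) : ∃ E, tangentIncl μ (X k) E = D := by
  have h0 : ∀ a, pullX μ (X k) a = 0 → D a = 0 := by
    intro a ha
    obtain ⟨g₁, g₂, rfl⟩ := mem_span_of_pullX_eq_zero μ k ha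
    have e₁ : algebraMap (OP (X k)) (OX μ (X k)) (eqn₁ k) = 0 := pullX_eqn₁ μ k
    have e₂ : algebraMap (OP (X k)) (OX μ (X k)) (eqn₂ μ k) = 0 := pullX_eqn₂ μ k
    rw [map_add, Derivation.leibniz, Derivation.leibniz, h₁, h₂, Algebra.smul_def (eqn₁ k),
      Algebra.smul_def (eqn₂ μ k), e₁, e₂]
    simp
  have hD : ∀ a b, pullX μ (X k) a = pullX μ (X k) b → D a = D b := fun a b hab => by
    rw [← sub_eq_zero, ← map_sub]
    exact h0 _ (by rw [map_sub, hab, sub_self])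
  obtain ⟨g, hg⟩ := (pullX_surjective μ (X_mem_gradP k)).hasRightInverse
  refine ⟨{ toFun := fun b => D (g b), map_add' := ?_, map_smul' := ?_, map_one_eq_zero' := ?_,
            leibniz' := ?_ }, Derivation.ext fun b => hD _ _ (hg _)⟩
  · intro x y
    rw [← map_add]
    exact hD _ _ (by rw [map_add, hg, hg, hg])
  · intro c x
    rw [RingHom.id_apply, ← Derivation.map_smul]
    exact hD _ _ (by rw [map_smul, hg, hg])
  · change D (g 1) = 0
    rw [← D.map_one_eq_zero]
    exact hD _ _ (by rw [hg, map_one])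
  · intro x y
    change D (g (x * y)) = x * D (g y) + y * D (g x)
    rw [hD (g (x * y)) (g x * g y) (by rw [map_mul, hg, hg, hg]), Derivation.leibniz,
      Algebra.smul_def, Algebra.smul_def]
    change pullX μ (X k) (g x) * _ + pullX μ (X k) (g y) * _ = _
    rw [hg, hg]

/-! ### A field transversal to the second quadric -/

/-- The derivative of the second equation along `x_p ∂_q - x_q ∂_p`, on `X ∩ D₊(x_k)`. -/
def slope (k p q : Fin (n + 3)) : OX μ (X k) :=
  algebraMap ℂ (OX μ (X k)) (2 * (μ q - μ p)) * (ratio μ k p * ratio μ k q)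

theorem one_div_mul_slope {i j : Fin (n + 3)} (hij : μ i ≠ μ j) (k : Fin (n + 3)) :
    algebraMap ℂ (OX μ (X k)) (1 / (μ j - μ i)) * slope μ k i j =
      2 * (ratio μ k i * ratio μ k j) := by
  rw [slope, ← mul_assoc, ← map_mul, one_div,
    show (μ j - μ i)⁻¹ * (2 * (μ j - μ i)) = 2 by
      have := sub_ne_zero.2 hij.symm
      field_simp, map_ofNat]

theorem sum_ratio_mul_slope (i k : Fin (n + 3)) :
    ∑ j ∈ Finset.univ.erase i, ratio μ k i * ratio μ k j * slope μ k i j = 0 := by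
  have h : ∀ j, ratio μ k i * ratio μ k j * slope μ k i j =
      2 * ratio μ k i ^ 2 * (algebraMap ℂ (OX μ (X k)) (μ j) * ratio μ k j ^ 2) -
        2 * ratio μ k i ^ 2 * algebraMap ℂ (OX μ (X k)) (μ i) * ratio μ k j ^ 2 := fun j => by
    rw [slope, map_mul, map_sub, map_ofNat]; ring
  have hi : ratio μ k i * ratio μ k i * slope μ k i i = 0 := by rw [h]; ring
  rw [Finset.sum_erase (f := fun j => ratio μ k i * ratio μ k j * slope μ k i j) _ hi,
    Finset.sum_congr rfl fun j _ => h j, Finset.sum_sub_distrib, ← Finset.mul_sum,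
    ← Finset.mul_sum, sum_ratio_sq, sum_mul_ratio_sq, mul_zero, mul_zero, sub_zero]

/-- The coefficient of `x_k ∂_b - x_b ∂_k` in the transversal field `normalField μ k`. -/
def normalCoeff (k b : Fin (n + 3)) : OX μ (X k) :=
  -(algebraMap ℂ (OX μ (X k)) (1 / (2 * (μ b - μ k))) * ratio μ k b)

/-- A vector field on `X ∩ D₊(x_k)` annihilating the first equation, along which the derivative of
the second equation is `1` when the `μ_b` are pairwise distinct. -/
def normalField (k : Fin (n + 3)) : TPX μ (X k) :=
  ∑ b ∈ Finset.univ.erase k, normalCoeff μ k b • rot μ k b k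

theorem normalCoeff_mul_slope {k b : Fin (n + 3)} (hb : μ b ≠ μ k) :
    normalCoeff μ k b * slope μ k k b = -ratio μ k b ^ 2 := by
  have h : 1 / (2 * (μ b - μ k)) * (2 * (μ b - μ k)) = 1 :=
    one_div_mul_cancel (mul_ne_zero two_ne_zero (sub_ne_zero.2 hb))
  have h' := congrArg (algebraMap ℂ (OX μ (X k))) h
  rw [map_mul, map_one] at h'
  rw [normalCoeff, slope, ratio_self]
  linear_combination (-ratio μ k b ^ 2) * h'

/-- The normalization of `normalField μ k`. Each summand is `-(x_b / x_k)²`, and the first equation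
gives `∑_{b ≠ k} (x_b / x_k)² = -1`. -/
theorem sum_normalCoeff_mul_slope (hμ : Function.Injective μ) (k : Fin (n + 3)) :
    ∑ b ∈ Finset.univ.erase k, normalCoeff μ k b * slope μ k k b = 1 := by
  rw [Finset.sum_congr rfl fun b hb => normalCoeff_mul_slope μ (hμ.ne (Finset.ne_of_mem_erase hb)),
    Finset.sum_neg_distrib, neg_eq_iff_eq_neg]
  have h := sum_ratio_sq μ k
  rw [← Finset.add_sum_erase _ _ (Finset.mem_univ k), ratio_self, one_pow] at h
  exact eq_neg_of_add_eq_zero_right h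

theorem normalField_eqn₁ (k : Fin (n + 3)) : normalField μ k (eqn₁ k) = 0 := by
  rw [normalField, sum_derivation_apply]
  exact Finset.sum_eq_zero fun b _ => by rw [Derivation.smul_apply, rot_eqn₁, smul_zero]

theorem normalField_eqn₂ (hμ : Function.Injective μ) (k : Fin (n + 3)) :
    normalField μ k (eqn₂ μ k) = 1 := by
  rw [normalField, sum_derivation_apply, ← sum_normalCoeff_mul_slope μ hμ k]
  exact Finset.sum_congr rfl fun b _ => by
    rw [Derivation.smul_apply, rot_eqn₂, smul_eq_mul, slope]

/-- Every `x_p ∂_q - x_q ∂_p` annihilates the first equation, so subtracting the multiple of the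
transversal field which accounts for the second equation makes it tangent to `X`. -/
theorem exists_rot_eq_tangentIncl_add (hμ : Function.Injective μ) (k p q : Fin (n + 3)) :
    ∃ E, rot μ p q k = tangentIncl μ (X k) E + slope μ k p q • normalField μ k := by
  obtain ⟨E, hE⟩ := exists_tangentIncl_eq μ k (rot μ p q k + (-slope μ k p q) • normalField μ k)
    (by rw [Derivation.add_apply, Derivation.smul_apply, rot_eqn₁, normalField_eqn₁, smul_zero,
      add_zero])
    (by rw [Derivation.add_apply, Derivation.smul_apply, rot_eqn₂, normalField_eqn₂ μ hμ,
      smul_eq_mul, mul_one, slope, add_neg_cancel])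
  refine ⟨E, Derivation.ext fun b => ?_⟩
  rw [hE, Derivation.add_apply, Derivation.add_apply, Derivation.smul_apply, Derivation.smul_apply,
    smul_eq_mul, smul_eq_mul]
  ring

/-- The projection of `x_p ∂_q - x_q ∂_p` to the vector fields tangent to `X`, along the
transversal field `normalField μ k`. -/
def tangentRot (hμ : Function.Injective μ) (k p q : Fin (n + 3)) : TX μ (X k) :=
  (exists_rot_eq_tangentIncl_add μ hμ k p q).choose

theorem rot_eq_tangentIncl_add (hμ : Function.Injective μ) (k p q : Fin (n + 3)) :
    rot μ p q k = tangentIncl μ (X k) (tangentRot μ hμ k p q) + slope μ k p q • normalField μ k :=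
  (exists_rot_eq_tangentIncl_add μ hμ k p q).choose_spec

/-! ### The contraction of `s_i` with the equations -/

/-- The coefficient of `(x_i ∂_j - x_j ∂_i)²` in `s_i`. -/
def quadCoeff (k i j : Fin (n + 3)) : OX μ (X k) :=
  algebraMap ℂ (OX μ (X k)) (1 / (μ j - μ i))

/-- The contraction of `s_i` with the second equation vanishes along `X`. -/
theorem sum_contract_rot (hμ : Function.Injective μ) (k i : Fin (n + 3)) :
    ∑ j ∈ Finset.univ.erase i, (quadCoeff μ k i j * slope μ k i j) • rot μ i j k = 0 := by
  refine Derivation.ext fun b => ?_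
  have h := congrArg (fun D => 2 * D b) (sum_ratio_smul_rot μ i k)
  simp only [sum_derivation_apply, Derivation.smul_apply, Derivation.zero_apply, smul_eq_mul,
    mul_zero, Finset.mul_sum] at h ⊢
  rw [← h]
  refine Finset.sum_congr rfl fun j hj => ?_
  rw [quadCoeff, one_div_mul_slope μ (hμ.ne (Finset.ne_of_mem_erase hj).symm), mul_assoc]

/-- The double contraction of `s_i` with the second equation vanishes along `X`. -/
theorem sum_quadCoeff_mul_slope_mul_slope (hμ : Function.Injective μ) (k i : Fin (n + 3)) :
    ∑ j ∈ Finset.univ.erase i, quadCoeff μ k i j * slope μ k i j * slope μ k i j = 0 := by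
  rw [← mul_zero (2 : OX μ (X k)), ← sum_ratio_mul_slope μ i k, Finset.mul_sum]
  refine Finset.sum_congr rfl fun j hj => ?_
  rw [quadCoeff,
    one_div_mul_slope μ (hμ.ne (Finset.ne_of_mem_erase hj).symm), mul_assoc]

/-- The contraction of `s_i` still vanishes after projection to `T_X`: its transversal component is
the double contraction, which is zero by `sum_quadCoeff_mul_slope_mul_slope`. -/
theorem sum_contract_tangentRot (hμ : Function.Injective μ) (k i : Fin (n + 3)) :
    ∑ j ∈ Finset.univ.erase i, (quadCoeff μ k i j * slope μ k i j) • tangentRot μ hμ k i j = 0 := by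
  apply tangentIncl_injective μ (X_mem_gradP k)
  refine Derivation.ext fun b => ?_
  have h := congrArg (fun D => D b) (sum_contract_rot μ hμ k i)
  simp only [sum_derivation_apply, rot_eq_tangentIncl_add μ hμ k i, Derivation.smul_apply,
    Derivation.add_apply, Derivation.zero_apply, smul_eq_mul] at h
  rw [map_sum, map_zero, sum_derivation_apply, Derivation.zero_apply, ← h,
    ← add_zero (Finset.sum _ _), ← zero_mul (normalField μ k b),
    ← sum_quadCoeff_mul_slope_mul_slope μ hμ k i, Finset.sum_mul, ← Finset.sum_add_distrib]
  refine Finset.sum_congr rfl fun j _ => ?_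
  rw [map_smul, Derivation.smul_apply, smul_eq_mul]
  ring

/-- The lift of `s_i` to `S² T_X` over `X ∩ D₊(x_k)`. -/
def liftQuadField (hμ : Function.Injective μ) (i k : Fin (n + 3)) :
    SymmetricAlgebra (OX μ (X k)) (TX μ (X k)) :=
  ∑ j ∈ Finset.univ.erase i, quadCoeff μ k i j •
    SymmetricAlgebra.ι (OX μ (X k)) (TX μ (X k)) (tangentRot μ hμ k i j) ^ 2

theorem symSqIncl_liftQuadField (hμ : Function.Injective μ) (i : Fin (n + 3)) :
    symSqIncl μ (liftQuadField μ hμ i) = quadField μ i := by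
  funext k
  refine symMap_sum_smul_ι_sq_eq (tangentIncl μ (X k)) _ _ (slope μ k i) _ _ (normalField μ k) ?_
    (sum_contract_tangentRot μ hμ k i) (sum_quadCoeff_mul_slope_mul_slope μ hμ k i)
  exact fun j _ => rot_eq_tangentIncl_add μ hμ k i j

/-! ### Restriction to the intersection of two charts -/

section Overlap

variable {k l : Fin (n + 3)} {w : Poly n} (hw : w = X k * X l) (hw' : w = X l * X k)

/-- The restriction of `x_i ∂_j - x_j ∂_i` to the overlap is the field induced there by the same
derivation of the polynomial ring. -/
theorem resTPX_rot (i j : Fin (n + 3)) (hm : w ∈ gradP n (1 + 1)) :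
    resTPX μ hw (rot μ i j k) = (Algebra.linearMap (OP w) (OX μ w)).compDer
      (awayDer (gradP n) (rotPoly i j) (rotPoly_mem i j) hm) := by
  refine restrictDer_eq_of_comp _ _ _ _ fun b => ?_
  have h := awayDer_awayRes (gradP n) (rotPoly i j) (rotPoly_mem i j) (X_mem_gradP k)
    (X_mem_gradP l) hw hm b
  exact (congrArg (algebraMap (OP w) (OX μ w)) h).trans (resOX_pullX μ hw _).symm

theorem overlap_mem {k l : Fin (n + 3)} {w : Poly n} (hw : w = X k * X l) : w ∈ gradP n (1 + 1) :=
  hw ▸ SetLike.mul_mem_graded (X_mem_gradP k) (X_mem_gradP l)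

/-- The restrictions of `x_i ∂_j - x_j ∂_i` to the two charts agree on the overlap. -/
theorem resTPX_rot_comm (i j : Fin (n + 3)) :
    resTPX μ hw' (rot μ i j l) = resTPX μ hw (rot μ i j k) := by
  rw [resTPX_rot μ hw i j (overlap_mem hw), resTPX_rot μ hw' i j (overlap_mem hw)]

theorem tangentIncl_resTX (D : TX μ (X k)) :
    tangentIncl μ w (resTX μ hw D) = resTPX μ hw (tangentIncl μ (X k) D) := by
  refine (restrictDer_eq_of_comp _ _ _ _ fun b => ?_).symm
  change resTX μ hw D (algebraMap (OP w) (OX μ w) (resOP hw b)) = _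
  rw [← resOX_pullX μ hw b]
  exact restrictDer_apply _ _ _ _ D _

theorem resOX_ratio (p : Fin (n + 3)) :
    resOX μ hw (ratio μ k p) = pullX μ w (Away.mk (gradP n) (overlap_mem hw) 1 (X p * X l)
      (by simpa using SetLike.mul_mem_graded (X_mem_gradP p) (X_mem_gradP l))) := by
  refine (resOX_pullX μ hw (ratioP k p)).trans ?_
  rw [ratioP, resOP, awayRes_mk (gradP n) (X_mem_gradP k) _ _ _ _ _ (overlap_mem hw)]
  simp only [pow_one]
  rfl

/-- The identity `x_p / x_l = (x_p / x_k) (x_k / x_l)` of functions on `X ∩ D₊(x_k x_l)`. -/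
theorem resOX_ratio_comm (p : Fin (n + 3)) :
    resOX μ hw' (ratio μ l p) = resOX μ hw (ratio μ k p) * resOX μ hw' (ratio μ l k) := by
  rw [resOX_ratio, resOX_ratio, resOX_ratio]
  apply OX_ext μ 2
  have h := fun a ha => toLoc_pow_mul_val μ (overlap_mem hw) 1 a ha
  rw [map_mul, pow_two, mul_mul_mul_comm, mul_assoc]
  simp only [pow_one] at h
  have hval : ∀ x, valOX μ w x = x.val := fun _ => rfl
  rw [hval, hval, hval, h, h, h]
  rw [← map_mul, ← map_mul]
  exact congrArg (toLoc μ w) (by rw [hw]; ring)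

theorem resOX_slope_comm (p q : Fin (n + 3)) :
    resOX μ hw' (slope μ l p q) =
      resOX μ hw (slope μ k p q) * resOX μ hw' (ratio μ l k) ^ 2 := by
  rw [slope, slope, map_mul (resOX μ hw'), map_mul (resOX μ hw), map_mul (resOX μ hw'),
    map_mul (resOX μ hw), AlgHom.commutes, AlgHom.commutes, resOX_ratio_comm μ hw hw' p,
    resOX_ratio_comm μ hw hw' q]
  ring

/-- The splitting of `x_p ∂_q - x_q ∂_p` into a tangent and a transversal part, restricted to the
overlap. -/
theorem resTPX_rot_eq_tangentIncl_add (hμ : Function.Injective μ) (p q : Fin (n + 3)) :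
    resTPX μ hw (rot μ p q k) = tangentIncl μ w (resTX μ hw (tangentRot μ hμ k p q)) +
      resOX μ hw (slope μ k p q) • resTPX μ hw (normalField μ k) := by
  rw [rot_eq_tangentIncl_add μ hμ, map_add, tangentIncl_resTX]
  exact congrArg _ (map_smulₛₗ _ _ _)

theorem TPX_smul_apply (f : Poly n) (c : OX μ f) (D : TPX μ f) (x : OP f) :
    (c • D) x = c * D x := rfl

theorem tangentIncl_smul_apply (f : Poly n) (c : OX μ f) (D : TX μ f) (x : OP f) :
    tangentIncl μ f (c • D) x = c * tangentIncl μ f D x := rfl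

/-- On `X ∩ D₊(x_k x_l)` the transversal fields of the two charts, scaled to the same equation,
differ by a field tangent to `X`. -/
theorem exists_normalField_eq_tangentIncl_add (hμ : Function.Injective μ) :
    ∃ δ, resOX μ hw' (ratio μ l k) ^ 2 • resTPX μ hw' (normalField μ l) =
      tangentIncl μ w δ + resTPX μ hw (normalField μ k) := by
  have hsum : ∑ b ∈ Finset.univ.erase l,
      resOX μ hw' (normalCoeff μ l b) * resOX μ hw' (slope μ l l b) = 1 := by
    rw [← map_one (resOX μ hw'), ← sum_normalCoeff_mul_slope μ hμ l, map_sum]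
    exact Finset.sum_congr rfl fun b _ => (map_mul (resOX μ hw') _ _).symm
  have hn : resTPX μ hw' (normalField μ l) = ∑ b ∈ Finset.univ.erase l,
      resOX μ hw' (normalCoeff μ l b) • resTPX μ hw' (rot μ l b l) := by
    rw [normalField, map_sum]
    exact Finset.sum_congr rfl fun b _ => map_smulₛₗ _ _ _
  have hδ : tangentIncl μ w (∑ b ∈ Finset.univ.erase l,
      ((resOX μ hw' (ratio μ l k) ^ 2 * resOX μ hw' (normalCoeff μ l b)) •
        resTX μ hw (tangentRot μ hμ k l b))) = ∑ b ∈ Finset.univ.erase l,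
      tangentIncl μ w ((resOX μ hw' (ratio μ l k) ^ 2 * resOX μ hw' (normalCoeff μ l b)) •
        resTX μ hw (tangentRot μ hμ k l b)) := map_sum _ _ _
  refine ⟨_, Eq.trans (Derivation.ext fun x => ?_) (congrArg (· + _) hδ.symm)⟩
  -- The difference is a combination of the tangent fields `tangentRot μ hμ k l b`: the transversal
  -- field of the chart `l` is a combination of the `x_l ∂_b - x_b ∂_l`, and its derivative of the
  -- second equation is normalized by `hsum`.
  rw [hn, TPX_smul_apply, Derivation.add_apply, sum_derivation_apply, sum_derivation_apply]
  refine mul_sum_eq_sum_add _ _ _ _ _ _ (fun b _ => ?_) hsum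
  rw [resTPX_rot_comm μ hw hw', resTPX_rot_eq_tangentIncl_add μ hw hμ, tangentIncl_smul_apply,
    TPX_smul_apply, Derivation.add_apply, TPX_smul_apply, resOX_slope_comm μ hw hw']
  ring

/-- The projections of the fields `x_i ∂_j - x_j ∂_i` made in two charts differ by multiples of a
single tangent field `δ`, with coefficients the derivatives of the second equation. -/
theorem exists_resTX_tangentRot_eq_add (hμ : Function.Injective μ) (i : Fin (n + 3)) :
    ∃ δ, ∀ j, resTX μ hw' (tangentRot μ hμ l i j) =
      resTX μ hw (tangentRot μ hμ k i j) + resOX μ hw (slope μ k i j) • δ := by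
  -- In terms of this `δ` the coefficient of the difference is the derivative of the second equation
  -- in the chart `l`, which is `(x_k / x_l)²` times that in the chart `k`.
  obtain ⟨δ, hδ⟩ := exists_normalField_eq_tangentIncl_add μ hw' hw hμ
  refine ⟨resOX μ hw' (ratio μ l k) ^ 2 • δ, fun j => ?_⟩
  apply tangentIncl_injective μ (overlap_mem hw)
  refine Derivation.ext fun x => ?_
  have h := congrArg (fun D => D x) (resTPX_rot_comm μ hw hw' i j)
  have hδ' := congrArg (fun D => D x) hδ
  rw [resTPX_rot_eq_tangentIncl_add μ hw' hμ, resTPX_rot_eq_tangentIncl_add μ hw hμ] at h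
  rw [map_add, map_smul, map_smul]
  simp only [Derivation.add_apply, Derivation.smul_apply, smul_eq_mul] at h hδ' ⊢
  have h₁ := resOX_slope_comm μ hw hw' i j
  have h₂ := resOX_slope_comm μ hw' hw i j
  linear_combination h + resOX μ hw' (slope μ l i j) * hδ' + tangentIncl μ w δ x * h₁ +
    resTPX μ hw (normalField μ k) x * h₂

/-- The local lifts agree on overlaps, because the contraction of `s_i` with the second equation
vanishes. -/
theorem symMap_resTX_liftQuadField (hμ : Function.Injective μ) (i : Fin (n + 3)) :
    symMap (resTX μ hw) (liftQuadField μ hμ i k) =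
      symMap (resTX μ hw') (liftQuadField μ hμ i l) := by
  obtain ⟨δ, hδ⟩ := exists_resTX_tangentRot_eq_add μ hw hw' hμ i
  have hc : ∀ j, (resOX μ hw').toRingHom (quadCoeff μ l i j) =
      (resOX μ hw).toRingHom (quadCoeff μ k i j) := fun j =>
    ((resOX μ hw').commutes _).trans ((resOX μ hw).commutes _).symm
  have h₁ : ∑ j ∈ Finset.univ.erase i,
      (resOX μ hw (quadCoeff μ k i j) * resOX μ hw (slope μ k i j)) •
        resTX μ hw (tangentRot μ hμ k i j) = 0 := by
    rw [← map_zero (resTX μ hw), ← sum_contract_tangentRot μ hμ k i, map_sum]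
    refine Finset.sum_congr rfl fun j _ => ?_
    rw [map_smulₛₗ, ← map_mul]
    rfl
  have h₂ : ∑ j ∈ Finset.univ.erase i,
      resOX μ hw (quadCoeff μ k i j) * resOX μ hw (slope μ k i j) *
        resOX μ hw (slope μ k i j) = 0 := by
    rw [← map_zero (resOX μ hw), ← sum_quadCoeff_mul_slope_mul_slope μ hμ k i, map_sum]
    exact Finset.sum_congr rfl fun j _ => by rw [map_mul, map_mul]
  have hkl := sum_smul_ι_sq_translate (Finset.univ.erase i)
    (fun j => resOX μ hw (quadCoeff μ k i j)) (fun j => resOX μ hw (slope μ k i j))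
    (fun j => resTX μ hw (tangentRot μ hμ k i j)) (fun j => resTX μ hw' (tangentRot μ hμ l i j))
    δ ?_ h₁ h₂
  · refine (symMap_sum_smul_ι_sq (resTX μ hw) _ _ _).trans (hkl.symm.trans
      (Eq.trans ?_ (symMap_sum_smul_ι_sq (resTX μ hw') _ _ _).symm))
    refine Finset.sum_congr rfl fun j _ => ?_
    rw [hc]
    rfl
  · exact fun j _ => hδ j

end Overlap

/-! ### The global sections -/

theorem liftQuadField_mem (hμ : Function.Injective μ) (i : Fin (n + 3)) :
    liftQuadField μ hμ i ∈ H0SymSqTX μ :=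
  ⟨fun _ => sum_smul_ι_sq_mem_symSq _ _ _,
    fun _ _ => symMap_resTX_liftQuadField μ rfl (mul_comm _ _) hμ i⟩

theorem quadField_mem (i : Fin (n + 3)) : quadField μ i ∈ H0SymSqTPX μ := by
  refine ⟨fun _ => sum_smul_ι_sq_mem_symSq _ _ _, fun k l => ?_⟩
  rw [quadField, quadField, symMap_sum_smul_ι_sq, symMap_sum_smul_ι_sq]
  refine Finset.sum_congr rfl fun j _ => ?_
  rw [resTPX_rot_comm μ (k := k) rfl (mul_comm _ _)]
  congr 1
  exact ((resOX μ _).commutes _).trans ((resOX μ _).commutes _).symm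

end TwoQuadrics
end

theorem mainTheorem11 (n : ℕ) (hn : 2 ≤ n) (μ : Fin (n + 3) → ℂ) (hμ : Function.Injective μ)
    (i : Fin (n + 3)) :
    TwoQuadrics.quadField μ i ∈ TwoQuadrics.H0SymSqTPX μ ∧
      ∃ t ∈ TwoQuadrics.H0SymSqTX μ,
        TwoQuadrics.symSqIncl μ t = TwoQuadrics.quadField μ i :=
  ⟨TwoQuadrics.quadField_mem μ i, _, TwoQuadrics.liftQuadField_mem μ hμ i,
    TwoQuadrics.symSqIncl_liftQuadField μ hμ i⟩
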